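/- Let $\mathbb S^3=\{(z_1,z_2)\in\mathbb C^2: |z_1|^2+|z_2|^2=1\}$ with its round metric, volume measure $\mathrm{dVol}$ and one-dimensional Hausdorff measure $\mathscr H^1$. For a family $\Delta$ of paths (continuous maps $\gamma\colon[0,1]\to\mathbb S^3$), the conformal modulus of $\Delta$ is $$\operatorname{Mod}_3(\Delta)=\inf_{\rho}\int_{\mathbb S^3}\rho^3\,\mathrm{dVol},$$ where the infimum is over all Borel measurable $\rho\colon\mathbb S^3\to[0,+\infty]$ with $\int_{\gamma([0,1])}\rho\,\mathrm d\mathscr H^1\ge 1$ for every $\gamma\in\Delta$. Let $$H_0=\{(z_1,0):|z_1|=1\},\qquad H_1=\{(0,z_2):|z_2|=1\}$$ be the two components of the Hopf link, and let $\Delta(H_0,H_1)$ be the family of all paths in $\mathbb S^3$ with one endpoint in $H_0$ and the other in $H_1$. Then $$\operatorname{Mod}_3(\Delta(H_0,H_1))=\frac{16\pi^3}{\Gamma(1/4)^4},$$ where $\Gamma(1/4)$ is the value of Euler's Gamma function. -/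

import Mathlib

open MeasureTheory

noncomputable section

/-- The class of densities admissible for a family `Γ` of paths `[0,1] → X`: measurable functions
`ρ : X → [0,∞]` with `∫_γ ρ dℋ¹ ≥ 1` for all `γ ∈ Γ`. The integral over a path is the integral over
its image with respect to one-dimensional Hausdorff measure. -/
def AdmissibleDensities {X : Type*} [EMetricSpace X] [MeasurableSpace X] [BorelSpace X]
    (Γ : Set C(unitInterval, X)) : Set (X → ENNReal) :=
  {ρ | Measurable ρ ∧ ∀ γ ∈ Γ, 1 ≤ ∫⁻ x in Set.range γ, ρ x ∂(Measure.hausdorffMeasure 1)}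

/-- The path `p`-modulus of `Γ` with respect to the volume measure `μ`. -/
def pathModulus {X : Type*} [EMetricSpace X] [MeasurableSpace X] [BorelSpace X]
    (μ : Measure X) (p : ℝ) (Γ : Set C(unitInterval, X)) : ENNReal :=
  ⨅ ρ ∈ AdmissibleDensities Γ, ∫⁻ x, ρ x ^ p ∂μ

/-- `Δ(C₀, C₁)`: the family of paths connecting `C₀` and `C₁`. -/
def connectingPaths {X : Type*} [TopologicalSpace X] (C₀ C₁ : Set X) : Set C(unitInterval, X) :=
  {γ | (γ 0 ∈ C₀ ∧ γ 1 ∈ C₁) ∨ (γ 0 ∈ C₁ ∧ γ 1 ∈ C₀)}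

/-- The unit sphere `𝕊³ = {(z₁, z₂) ∈ ℂ² : |z₁|² + |z₂|² = 1}`. Its metric is the chordal one, which
has the same one-dimensional Hausdorff measure as the geodesic distance of the round metric. -/
abbrev S3 : Type := Metric.sphere (0 : EuclideanSpace ℂ (Fin 2)) 1

/-- The Riemannian volume of the round metric on `𝕊³`: the surface measure induced by Lebesgue
measure on `ℂ² = ℝ⁴` (total mass `2π²`). -/
def volS3 : Measure S3 :=
  (volume : Measure (EuclideanSpace ℂ (Fin 2))).toSphere

/-- The component `H₀ = {(z₁, 0) : |z₁| = 1}` of the Hopf link. -/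
def hopfLink₀ : Set S3 := {x | ‖x.1 0‖ = 1 ∧ x.1 1 = 0}

/-- The component `H₁ = {(0, z₂) : |z₂| = 1}` of the Hopf link. -/
def hopfLink₁ : Set S3 := {x | x.1 0 = 0 ∧ ‖x.1 1‖ = 1}

end

open MeasureTheory Set Real Filter Topology

/-! In Hopf coordinates the volume is `cos t sin t dα dβ dt`, with `t` the geodesic distance to
`hopfLink₀`. Put `w = cos t sin t` and `I = ∫ w^(-1/2)` over `(0, π/2)`. Lower bound: an admissible
`ρ` has integral at least 1 along each geodesic arc with `α`, `β` fixed. Hölder with weight `w`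
(`lintegral_rpow_three_le`) gives `∫ w ρ³ dt ≥ I⁻²` on each arc, and integrating over the angles
gives `(2π)² I⁻²`. Upper bound: equality in Hölder dictates the density `I⁻¹ w^(-1/2)`, a function
of `t` alone. It is admissible because every connecting path sweeps out all `t` in `[0, π/2]` and
`t` does not increase one-dimensional measure (`hausdorffMeasure_hopfAngle_image_le`). The
substitution `x = sin² t` makes `I` a Beta integral, whence the Gamma value. -/

/-! ### Integration on the sphere in Hopf coordinates. -/

/-- The linear isometry `ℂ² ≃ ℂ × ℂ` for the Euclidean norms. -/
noncomputable def euclideanProdEquiv :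
    EuclideanSpace ℂ (Fin 2) ≃ₗᵢ[ℝ] WithLp 2 (ℂ × ℂ) where
  toFun x := WithLp.toLp 2 (x 0, x 1)
  invFun p := !₂[p.fst, p.snd]
  map_add' x y := rfl
  map_smul' c x := rfl
  left_inv x := by ext i; fin_cases i <;> rfl
  right_inv p := rfl
  norm_map' x := by
    rw [WithLp.prod_norm_eq_of_L2, EuclideanSpace.norm_eq, Fin.sum_univ_two]
    rfl

theorem lintegral_euclidean_complex_two {F : EuclideanSpace ℂ (Fin 2) → ENNReal}
    (hF : Measurable F) : ∫⁻ x, F x = ∫⁻ z : ℂ, ∫⁻ w : ℂ, F !₂[z, w] := by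
  have h1 : MeasurePreserving (fun p : ℂ × ℂ => euclideanProdEquiv.symm (WithLp.toLp 2 p)) :=
    euclideanProdEquiv.symm.measurePreserving.comp (WithLp.volume_preserving_toLp ℂ ℂ)
  have h2 := h1.lintegral_comp hF
  rw [← h2, Measure.volume_eq_prod]
  exact lintegral_prod _ (hF.comp h1.measurable).aemeasurable

theorem lintegral_complex_polar {f : ℂ → ENNReal} (hf : Measurable f) :
    ∫⁻ z, f z = ∫⁻ α in Ioo (-π) π, ∫⁻ r in Ioi (0 : ℝ),
      ENNReal.ofReal r * f (r * Complex.exp (α * Complex.I)) := by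
  rw [← Complex.lintegral_comp_polarCoord_symm, polarCoord_target, Measure.volume_eq_prod,
    ← Measure.prod_restrict, lintegral_prod_symm]
  · simp [Complex.polarCoord_symm_apply, Complex.exp_mul_I]
  · simp only [Complex.polarCoord_symm_apply, smul_eq_mul]
    fun_prop

/-- Polar coordinates in the first quadrant. -/
theorem lintegral_quadrant_polar {G : ℝ × ℝ → ENNReal} (hG : Measurable G) :
    ∫⁻ r in Ioi (0 : ℝ), ∫⁻ s in Ioi (0 : ℝ), G (r, s) =
      ∫⁻ t in Ioo 0 (π / 2), ∫⁻ r in Ioi (0 : ℝ),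
        ENNReal.ofReal r * G (r * cos t, r * sin t) := by
  have hQ : MeasurableSet (Ioi (0 : ℝ) ×ˢ Ioi (0 : ℝ)) := measurableSet_Ioi.prod measurableSet_Ioi
  rw [lintegral_lintegral (f := fun r s => G (r, s)) (by fun_prop), Measure.prod_restrict,
    ← Measure.volume_eq_prod, ← lintegral_indicator hQ, ← lintegral_comp_polarCoord_symm,
    polarCoord_target, Measure.volume_eq_prod, ← Measure.prod_restrict, lintegral_prod_symm]
  · rw [← lintegral_indicator measurableSet_Ioo, ← lintegral_indicator measurableSet_Ioo]
    refine lintegral_congr fun t => ?_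
    by_cases ht : t ∈ Ioo (-π) π
    · rw [indicator_of_mem ht]
      by_cases ht' : t ∈ Ioo 0 (π / 2)
      · rw [indicator_of_mem ht']
        refine setLIntegral_congr_fun measurableSet_Ioi fun r hr => ?_
        have h1 : 0 < cos t := cos_pos_of_mem_Ioo ⟨by linarith [ht'.1, pi_pos], ht'.2⟩
        have h2 : 0 < sin t := sin_pos_of_mem_Ioo ⟨ht'.1, ht.2⟩
        have hr' : 0 < r := hr
        have : (r * cos t, r * sin t) ∈ Ioi (0 : ℝ) ×ˢ Ioi (0 : ℝ) :=
          ⟨mul_pos hr' h1, mul_pos hr' h2⟩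
        simp only [polarCoord_symm_apply, indicator_of_mem this, smul_eq_mul]
      · rw [indicator_of_notMem ht']
        refine (setLIntegral_congr_fun measurableSet_Ioi fun r hr => ?_).trans lintegral_zero
        have hr' : 0 < r := hr
        have : (r * cos t, r * sin t) ∉ Ioi (0 : ℝ) ×ˢ Ioi (0 : ℝ) := by
          rintro ⟨h1, h2⟩
          have h1 : 0 < cos t := (mul_pos_iff_of_pos_left hr').1 h1
          have h2 : 0 < sin t := (mul_pos_iff_of_pos_left hr').1 h2
          refine ht' ⟨?_, ?_⟩
          · by_contra h
            exact absurd (sin_nonpos_of_nonpos_of_neg_pi_le (not_lt.1 h) ht.1.le) (not_le.2 h2)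
          · by_contra h
            refine absurd (cos_nonpos_of_pi_div_two_le_of_le (not_lt.1 h) ?_) (not_le.2 h1)
            linarith [ht.2, pi_pos]
        simp only [polarCoord_symm_apply, indicator_of_notMem this, smul_zero]
    · rw [indicator_of_notMem ht, indicator_of_notMem]
      exact fun h => ht ⟨by linarith [h.1, pi_pos], by linarith [h.2, pi_pos]⟩
  · refine Measurable.aemeasurable ?_
    refine Measurable.smul (f := fun p : ℝ × ℝ => ENNReal.ofReal p.1) (by fun_prop) ?_
    refine Measurable.comp (hG.indicator hQ) continuous_polarCoord_symm.measurable

/-- The point of `𝕊³` with Hopf coordinates `α`, `β`, `t`. -/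
noncomputable def hopfPoint (α β t : ℝ) : S3 :=
  ⟨!₂[cos t * Complex.exp (α * Complex.I), sin t * Complex.exp (β * Complex.I)], by
    rw [mem_sphere_zero_iff_norm, EuclideanSpace.norm_eq, Fin.sum_univ_two]
    simp [Complex.norm_exp_ofReal_mul_I, -Complex.ofReal_cos, -Complex.ofReal_sin]⟩

theorem finrank_euclidean_complex_two :
    Module.finrank ℝ (EuclideanSpace ℂ (Fin 2)) = 4 := by
  rw [← Module.finrank_mul_finrank ℝ ℂ]; simp

/-- Integration over the sphere as integration of a `0`-homogeneous function over the ball. -/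
theorem lintegral_volS3_eq_ball {g : EuclideanSpace ℂ (Fin 2) → ENNReal} (hg : Measurable g) :
    (∫⁻ x : S3, g x ∂volS3) * ENNReal.ofReal (1 / 4) =
      ∫⁻ x, (Ioo (0 : ℝ) 1).indicator 1 ‖x‖ * g (‖x‖⁻¹ • x) := by
  have hmp := (volume : Measure (EuclideanSpace ℂ (Fin 2))).measurePreserving_homeomorphUnitSphereProd
  rw [finrank_euclidean_complex_two] at hmp
  let one' : Ioi (0 : ℝ) := ⟨1, mem_Ioi.2 one_pos⟩
  have hS : MeasurableSet ({0}ᶜ : Set (EuclideanSpace ℂ (Fin 2))) := (measurableSet_singleton 0).compl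
  have h0 : ∫⁻ x, (Ioo (0 : ℝ) 1).indicator 1 ‖x‖ * g (‖x‖⁻¹ • x) =
      ∫⁻ x in ({0}ᶜ : Set (EuclideanSpace ℂ (Fin 2))),
        (Ioo (0 : ℝ) 1).indicator 1 ‖x‖ * g (‖x‖⁻¹ • x) := by
    rw [← lintegral_indicator hS]
    refine lintegral_congr fun x => ?_
    by_cases hx : x = 0 <;> simp [hx]
  rw [h0, ← lintegral_subtype_comap hS]
  have h1 : ∀ x : ({0}ᶜ : Set (EuclideanSpace ℂ (Fin 2))),
      (Ioo (0 : ℝ) 1).indicator (1 : ℝ → ENNReal) ‖(x : EuclideanSpace ℂ (Fin 2))‖ *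
        g (‖(x : EuclideanSpace ℂ (Fin 2))‖⁻¹ • (x : EuclideanSpace ℂ (Fin 2))) =
      (fun p : S3 × Ioi (0 : ℝ) => g p.1 * (Iio one').indicator 1 p.2)
        (homeomorphUnitSphereProd _ x) := by
    intro x
    have hx : 0 < ‖(x : EuclideanSpace ℂ (Fin 2))‖ := norm_pos_iff.2 x.2
    have : (homeomorphUnitSphereProd _ x).2 ∈ Iio one' ↔
        ‖(x : EuclideanSpace ℂ (Fin 2))‖ ∈ Ioo (0 : ℝ) 1 := by
      rw [mem_Iio, ← Subtype.coe_lt_coe, homeomorphUnitSphereProd_apply_snd_coe]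
      simp [one', hx]
    simp only [homeomorphUnitSphereProd_apply_fst_coe]
    rw [mul_comm]
    congr 1
    by_cases h : ‖(x : EuclideanSpace ℂ (Fin 2))‖ ∈ Ioo (0 : ℝ) 1
    · rw [indicator_of_mem h, indicator_of_mem (this.2 h)]; rfl
    · rw [indicator_of_notMem h, indicator_of_notMem (fun h' => h (this.1 h'))]
  have hg' : Measurable fun p : S3 × Ioi (0 : ℝ) =>
      g p.1 * (Iio one').indicator (1 : Ioi (0 : ℝ) → ENNReal) p.2 :=
    (hg.comp (measurable_subtype_coe.comp measurable_fst)).mul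
      ((measurable_one.indicator measurableSet_Iio).comp measurable_snd)
  refine Eq.trans ?_ ((lintegral_congr h1).trans (hmp.lintegral_comp hg')).symm
  refine Eq.trans ?_ (lintegral_prod_mul (f := fun x : S3 => g x)
    (g := (Iio one').indicator (1 : Ioi (0 : ℝ) → ENNReal))
    (hg.comp measurable_subtype_coe).aemeasurable
    (measurable_one.indicator measurableSet_Iio).aemeasurable).symm
  -- The factor `1 / 4` is the radial mass `∫₀¹ r³ dr`, real dimension 4 giving the exponent 3.
  rw [lintegral_indicator_one measurableSet_Iio, Measure.volumeIoiPow_apply_Iio]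
  congr 2
  norm_num [one']

theorem lintegral_Ioo_cube :
    ∫⁻ r in Ioo (0 : ℝ) 1, ENNReal.ofReal (r ^ 3) = ENNReal.ofReal (1 / 4) := by
  rw [restrict_Ioo_eq_restrict_Ioc, ← ofReal_integral_eq_lintegral_ofReal,
    ← intervalIntegral.integral_of_le zero_le_one]
  · congr 1; simp; norm_num
  · exact (intervalIntegral.intervalIntegrable_pow 3).1
  · filter_upwards [ae_restrict_mem measurableSet_Ioc] with r hr using pow_nonneg hr.1.le 3

theorem norm_hopfPoint (α β t : ℝ) : ‖(hopfPoint α β t : EuclideanSpace ℂ (Fin 2))‖ = 1 :=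
  norm_eq_of_mem_sphere _

/-- The volume of `𝕊³` in Hopf coordinates. -/
theorem lintegral_volS3 {f : S3 → ENNReal} (hf : Measurable f) :
    ∫⁻ x, f x ∂volS3 = ∫⁻ α in Ioo (-π) π, ∫⁻ β in Ioo (-π) π, ∫⁻ t in Ioo 0 (π / 2),
      ENNReal.ofReal (cos t * sin t) * f (hopfPoint α β t) := by
  have hemb : MeasurableEmbedding ((↑) : S3 → EuclideanSpace ℂ (Fin 2)) :=
    MeasurableEmbedding.subtype_coe Metric.isClosed_sphere.measurableSet
  obtain ⟨g, hg, rfl⟩ := hemb.exists_measurable_extend hf fun _ => ⟨0⟩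
  have key := lintegral_volS3_eq_ball hg
  set F : EuclideanSpace ℂ (Fin 2) → ENNReal := fun x =>
    (Ioo (0 : ℝ) 1).indicator 1 ‖x‖ * g (‖x‖⁻¹ • x) with hFdef
  have hF : Measurable F := by
    refine Measurable.mul ?_ (hg.comp (by fun_prop))
    exact (measurable_one.indicator measurableSet_Ioo).comp measurable_norm
  have hpair : Measurable fun p : ℂ × ℂ => F !₂[p.1, p.2] := by
    refine hF.comp ?_
    exact (euclideanProdEquiv.symm.continuous.measurable).comp
      (WithLp.volume_preserving_toLp ℂ ℂ).measurable
  have e1 : ∫⁻ x, F x = ∫⁻ α in Ioo (-π) π, ∫⁻ r in Ioi (0 : ℝ), ∫⁻ β in Ioo (-π) π,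
      ∫⁻ s in Ioi (0 : ℝ), ENNReal.ofReal r * (ENNReal.ofReal s *
        F !₂[r * Complex.exp (α * Complex.I), s * Complex.exp (β * Complex.I)]) := by
    rw [lintegral_euclidean_complex_two hF, lintegral_complex_polar hpair.lintegral_prod_right']
    refine lintegral_congr fun α => lintegral_congr fun r => ?_
    rw [lintegral_complex_polar (by fun_prop), ← lintegral_const_mul']
    · refine lintegral_congr fun β => ?_
      rw [← lintegral_const_mul' _ _ ENNReal.ofReal_ne_top]
    · exact ENNReal.ofReal_ne_top
  have hG : ∀ α : ℝ, Measurable fun p : (ℝ × ℝ) × ℝ => ENNReal.ofReal p.1.1 * (ENNReal.ofReal p.2 *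
      F !₂[p.1.1 * Complex.exp (α * Complex.I), p.2 * Complex.exp (p.1.2 * Complex.I)]) := by
    intro α
    have : Measurable fun p : (ℝ × ℝ) × ℝ =>
      F !₂[p.1.1 * Complex.exp (α * Complex.I), p.2 * Complex.exp (p.1.2 * Complex.I)] :=
      hpair.comp (g := fun p : ℂ × ℂ => F !₂[p.1, p.2])
        (f := fun p : (ℝ × ℝ) × ℝ =>
          (p.1.1 * Complex.exp (α * Complex.I), p.2 * Complex.exp (p.1.2 * Complex.I)))
        (by fun_prop)
    fun_prop
  -- The Jacobians multiply to `r · (r cos t) · (r sin t) = r³ cos t sin t`; the radial integral is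
  -- again `1 / 4` and cancels at the end.
  have e2 : ∀ α β t : ℝ, t ∈ Ioo 0 (π / 2) → (∫⁻ r in Ioi (0 : ℝ), ENNReal.ofReal r *
      (ENNReal.ofReal (r * cos t) * (ENNReal.ofReal (r * sin t) *
        F !₂[(r * cos t : ℝ) * Complex.exp (α * Complex.I),
          (r * sin t : ℝ) * Complex.exp (β * Complex.I)]))) =
      ENNReal.ofReal (cos t * sin t) * g (hopfPoint α β t) * ENNReal.ofReal (1 / 4) := by
    intro α β t ht
    have h1 : 0 < cos t := cos_pos_of_mem_Ioo ⟨by linarith [ht.1, pi_pos], ht.2⟩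
    have h2 : 0 < sin t := sin_pos_of_mem_Ioo ⟨ht.1, by linarith [ht.2, pi_pos]⟩
    rw [← lintegral_Ioo_cube, ← lintegral_const_mul _ (by fun_prop),
      ← lintegral_indicator measurableSet_Ioo, ← lintegral_indicator measurableSet_Ioi]
    refine lintegral_congr fun r => ?_
    by_cases hr : r ∈ Ioi (0 : ℝ)
    · have hr' : 0 < r := hr
      rw [indicator_of_mem hr]
      have e : !₂[((r * cos t : ℝ) : ℂ) * Complex.exp (α * Complex.I),
          ((r * sin t : ℝ) : ℂ) * Complex.exp (β * Complex.I)] =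
          r • (hopfPoint α β t : EuclideanSpace ℂ (Fin 2)) := by
        ext i
        fin_cases i <;> simp [hopfPoint, mul_assoc]
      have hn : ‖r • (hopfPoint α β t : EuclideanSpace ℂ (Fin 2))‖ = r := by
        rw [norm_smul, norm_hopfPoint, mul_one, Real.norm_of_nonneg hr'.le]
      rw [e, hFdef]
      simp only [hn, inv_smul_smul₀ hr'.ne']
      by_cases hr1 : r ∈ Ioo (0 : ℝ) 1
      · rw [indicator_of_mem hr1, indicator_of_mem hr1, Pi.one_apply, one_mul, mul_right_comm,
          ← ENNReal.ofReal_mul (by positivity), ← mul_assoc, ← mul_assoc,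
          ← ENNReal.ofReal_mul (by positivity), ← ENNReal.ofReal_mul (by positivity)]
        congr 2
        ring
      · simp [indicator_of_notMem hr1]
    · rw [indicator_of_notMem hr, indicator_of_notMem fun h => hr h.1]
  rw [← ENNReal.mul_left_inj (c := ENNReal.ofReal (1 / 4)) (by simp) ENNReal.ofReal_ne_top]
  refine key.trans (e1.trans ?_)
  rw [← lintegral_mul_const' _ _ ENNReal.ofReal_ne_top]
  refine lintegral_congr fun α => ?_
  -- Exchanging `r` and `β` puts the two radii side by side, ready for polar coordinates in the
  -- quadrant.
  rw [← lintegral_mul_const' _ _ ENNReal.ofReal_ne_top,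
    lintegral_lintegral_swap (hG α).lintegral_prod_right'.aemeasurable]
  refine lintegral_congr fun β => ?_
  rw [← lintegral_mul_const' _ _ ENNReal.ofReal_ne_top]
  refine (lintegral_quadrant_polar (G := fun p => ENNReal.ofReal p.1 * (ENNReal.ofReal p.2 *
      F !₂[p.1 * Complex.exp (α * Complex.I), p.2 * Complex.exp (β * Complex.I)])) ?_).trans ?_
  · exact (hG α).comp (g := fun p : (ℝ × ℝ) × ℝ => ENNReal.ofReal p.1.1 * (ENNReal.ofReal p.2 *
      F !₂[p.1.1 * Complex.exp (α * Complex.I), p.2 * Complex.exp (p.1.2 * Complex.I)]))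
      (f := fun p : ℝ × ℝ => ((p.1, β), p.2)) (by fun_prop)
  · exact setLIntegral_congr_fun measurableSet_Ioo fun t ht => e2 α β t ht

/-! ### The lemniscate-type integral. -/

theorem cos_mul_sin_pos {t : ℝ} (ht : t ∈ Ioo 0 (π / 2)) : 0 < cos t * sin t :=
  mul_pos (cos_pos_of_mem_Ioo ⟨by linarith [ht.1, pi_pos], ht.2⟩)
    (sin_pos_of_mem_Ioo ⟨ht.1, by linarith [ht.2, pi_pos]⟩)

theorem image_sin_sq : (fun t => sin t ^ 2) '' Ioo 0 (π / 2) = Ioo 0 1 := by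
  ext x
  constructor
  · rintro ⟨t, ht, rfl⟩
    have hc : 0 < cos t := cos_pos_of_mem_Ioo ⟨by linarith [ht.1, pi_pos], ht.2⟩
    have hs : 0 < sin t := sin_pos_of_mem_Ioo ⟨ht.1, by linarith [ht.2, pi_pos]⟩
    exact ⟨by positivity, by nlinarith [sin_sq_add_cos_sq t, pow_pos hc 2]⟩
  · intro hx
    have h0 : 0 < √x := Real.sqrt_pos.2 hx.1
    have h1 : √x < 1 := by rw [Real.sqrt_lt' one_pos]; simpa using hx.2
    refine ⟨arcsin √x, ⟨arcsin_pos.2 h0, arcsin_lt_pi_div_two.2 h1⟩, ?_⟩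
    simp only [sin_arcsin (by linarith : -1 ≤ √x) h1.le, Real.sq_sqrt hx.1.le]

theorem injOn_sin_sq : InjOn (fun t => sin t ^ 2) (Ioo 0 (π / 2)) := by
  intro s hs t ht h
  have hs' : 0 < sin s := sin_pos_of_mem_Ioo ⟨hs.1, by linarith [hs.2, pi_pos]⟩
  have ht' : 0 < sin t := sin_pos_of_mem_Ioo ⟨ht.1, by linarith [ht.2, pi_pos]⟩
  have : sin s = sin t := (pow_left_inj₀ hs'.le ht'.le two_ne_zero).1 h
  exact injOn_sin ⟨by linarith [hs.1, pi_pos], hs.2.le⟩ ⟨by linarith [ht.1, pi_pos], ht.2.le⟩ this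

/-- The lemniscate-type integral `∫₀^{π/2} (cos t sin t)^{-1/2} dt = Γ(1/4)² / (2√π)`. -/
theorem lintegral_cos_mul_sin_rpow :
    ∫⁻ t in Ioo 0 (π / 2), ENNReal.ofReal ((cos t * sin t) ^ (-(1 / 2) : ℝ)) =
      ENNReal.ofReal (Gamma (1 / 4) ^ 2 / (2 * √π)) := by
  -- Total mass 1 of the Beta(1/4, 1/4) density, pulled back by `x = sin² t`: the powers give `(cos
  -- t sin t)^(-3/2)` and the Jacobian `2 sin t cos t` raises the exponent to `-1/2`.
  have hB := ProbabilityTheory.lintegral_betaPDF_eq_one (α := 1 / 4) (β := 1 / 4)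
    (by norm_num) (by norm_num)
  have hb : ProbabilityTheory.beta (1 / 4) (1 / 4) = Gamma (1 / 4) ^ 2 / √π := by
    rw [ProbabilityTheory.beta, show (1 / 4 + 1 / 4 : ℝ) = 1 / 2 by norm_num, Gamma_one_half_eq, sq]
  have hG : 0 < Gamma (1 / 4) := Gamma_pos_of_pos (by norm_num)
  have hbpos : 0 < ProbabilityTheory.beta (1 / 4) (1 / 4) :=
    ProbabilityTheory.beta_pos (by norm_num) (by norm_num)
  rw [ProbabilityTheory.lintegral_betaPDF, ← image_sin_sq,
    lintegral_image_eq_lintegral_abs_deriv_mul (f' := fun t => 2 * sin t * cos t) measurableSet_Ioo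
      (fun t _ => by simpa using ((hasDerivAt_sin t).fun_pow 2).hasDerivWithinAt) injOn_sin_sq] at hB
  have hcongr : ∀ t ∈ Ioo 0 (π / 2), ENNReal.ofReal |2 * sin t * cos t| *
      ENNReal.ofReal (1 / ProbabilityTheory.beta (1 / 4) (1 / 4) * (sin t ^ 2) ^ (1 / 4 - 1 : ℝ) *
        (1 - sin t ^ 2) ^ (1 / 4 - 1 : ℝ)) =
      ENNReal.ofReal (2 / ProbabilityTheory.beta (1 / 4) (1 / 4)) *
        ENNReal.ofReal ((cos t * sin t) ^ (-(1 / 2) : ℝ)) := by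
    intro t ht
    have hc : 0 < cos t := cos_pos_of_mem_Ioo ⟨by linarith [ht.1, pi_pos], ht.2⟩
    have hs : 0 < sin t := sin_pos_of_mem_Ioo ⟨ht.1, by linarith [ht.2, pi_pos]⟩
    have hcs := mul_pos hc hs
    rw [← ENNReal.ofReal_mul (abs_nonneg _), ← ENNReal.ofReal_mul (by positivity),
      abs_of_pos (by positivity), ← cos_sq']
    congr 1
    have h1 : (sin t ^ 2) ^ (1 / 4 - 1 : ℝ) * (cos t ^ 2) ^ (1 / 4 - 1 : ℝ) =
        (cos t * sin t) ^ (-(3 / 2) : ℝ) := by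
      rw [← mul_rpow (by positivity) (by positivity), ← mul_pow, ← rpow_natCast,
        ← rpow_mul (by positivity), mul_comm (sin t)]
      norm_num
    have h2 : (cos t * sin t) ^ (-(1 / 2) : ℝ) =
        (cos t * sin t) * (cos t * sin t) ^ (-(3 / 2) : ℝ) := by
      rw [← rpow_one_add' hcs.le (by norm_num)]
      norm_num
    rw [mul_assoc (1 / _), h1, h2]
    ring
  rw [setLIntegral_congr_fun measurableSet_Ioo hcongr, lintegral_const_mul'
    _ _ ENNReal.ofReal_ne_top] at hB
  rw [ENNReal.eq_inv_of_mul_eq_one_left ((mul_comm _ _).trans hB),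
    ← ENNReal.ofReal_inv_of_pos (by positivity), hb]
  congr 1
  field_simp

/-! ### Lower bound: geodesic arcs and Hölder's inequality. -/

theorem dist_sq_hopfPoint (α β s t : ℝ) :
    dist (hopfPoint α β s) (hopfPoint α β t) ^ 2 = 2 - 2 * cos (s - t) := by
  have h : ∀ (a b θ : ℝ), dist ((a : ℂ) * Complex.exp (θ * Complex.I))
      ((b : ℂ) * Complex.exp (θ * Complex.I)) ^ 2 = (a - b) ^ 2 := by
    intro a b θ
    rw [dist_eq_norm, ← sub_mul, norm_mul, Complex.norm_exp_ofReal_mul_I, mul_one,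
      ← Complex.ofReal_sub, Complex.norm_real, Real.norm_eq_abs, sq_abs]
  rw [Subtype.dist_eq, EuclideanSpace.dist_eq, Real.sq_sqrt (by positivity), Fin.sum_univ_two,
    cos_sub]
  have h0 := h (cos s) (cos t) α
  have h1 := h (sin s) (sin t) β
  simp only [hopfPoint, Matrix.cons_val_zero, Matrix.cons_val_one, h0, h1]
  nlinarith [sin_sq_add_cos_sq s, sin_sq_add_cos_sq t]

/-- A chord is no longer than its arc, in the form `1 - x²/2 ≤ cos x`. -/
theorem lipschitzWith_hopfPoint (α β : ℝ) : LipschitzWith 1 (hopfPoint α β) := by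
  refine LipschitzWith.of_dist_le_mul fun s t => ?_
  rw [NNReal.coe_one, one_mul, Real.dist_eq]
  refine abs_le_of_sq_le_sq' ?_ (abs_nonneg _) |>.2
  rw [dist_sq_hopfPoint, sq_abs]
  linarith [one_sub_sq_div_two_le_cos (x := s - t)]

/-- A 1-Lipschitz map does not increase `ℋ¹`, so the pushforward of Lebesgue measure on `S`
dominates `ℋ¹` on the image. Injectivity plays no role in this direction. -/
theorem setLIntegral_hausdorffMeasure_image_le {X : Type*} [EMetricSpace X] [MeasurableSpace X]
    [BorelSpace X] {c : ℝ → X} (hc : LipschitzWith 1 c) (S : Set ℝ) {ρ : X → ENNReal}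
    (hρ : Measurable ρ) :
    ∫⁻ x in c '' S, ρ x ∂(Measure.hausdorffMeasure 1) ≤ ∫⁻ t in S, ρ (c t) := by
  rw [← lintegral_map hρ hc.continuous.measurable]
  refine lintegral_mono' (Measure.le_iff.2 fun A hA => ?_) le_rfl
  rw [Measure.restrict_apply hA, Measure.map_apply hc.continuous.measurable hA,
    Measure.restrict_apply (hc.continuous.measurable hA), inter_comm, ← image_inter_preimage,
    ← hausdorffMeasure_real, inter_comm]
  simpa using hc.hausdorffMeasure_image_le zero_le_one (c ⁻¹' A ∩ S)

/-- The geodesic arc from `hopfLink₀` to `hopfLink₁` with angles `α`, `β`. -/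
noncomputable def hopfArc (α β : ℝ) : C(unitInterval, S3) :=
  ⟨fun s => hopfPoint α β (π / 2 * s),
    (lipschitzWith_hopfPoint α β).continuous.comp (by fun_prop)⟩

theorem hopfArc_mem (α β : ℝ) : hopfArc α β ∈ connectingPaths hopfLink₀ hopfLink₁ := by
  refine Or.inl ⟨?_, ?_⟩
  · simp [hopfArc, hopfLink₀, hopfPoint, Complex.norm_exp_ofReal_mul_I]
  · have h0 : Complex.cos (π / 2) = 0 := Complex.cos_pi_div_two
    have h1 : Complex.sin (π / 2) = 1 := Complex.sin_pi_div_two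
    simp [hopfArc, hopfLink₁, hopfPoint, Complex.norm_exp_ofReal_mul_I]

theorem range_hopfArc_subset (α β : ℝ) :
    range (hopfArc α β) ⊆ hopfPoint α β '' Icc 0 (π / 2) := by
  rintro _ ⟨s, rfl⟩
  refine ⟨π / 2 * s, ⟨mul_nonneg (by positivity) s.2.1, ?_⟩, rfl⟩
  exact mul_le_of_le_one_right (by positivity) s.2.2

theorem measurable_hopfPoint (α β : ℝ) : Measurable (hopfPoint α β) :=
  (lipschitzWith_hopfPoint α β).continuous.measurable

theorem one_le_lintegral_hopfPoint {ρ : S3 → ENNReal}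
    (hρ : ρ ∈ AdmissibleDensities (connectingPaths hopfLink₀ hopfLink₁)) (α β : ℝ) :
    1 ≤ ∫⁻ t in Ioo 0 (π / 2), ρ (hopfPoint α β t) := by
  refine (hρ.2 _ (hopfArc_mem α β)).trans ((lintegral_mono_set (range_hopfArc_subset α β)).trans ?_)
  rw [setLIntegral_congr Ioo_ae_eq_Icc]
  exact setLIntegral_hausdorffMeasure_image_le (lipschitzWith_hopfPoint α β) _ hρ.1

/-- Hölder's inequality with weight `cos t sin t`. -/
theorem lintegral_rpow_three_le {f : ℝ → ENNReal} (hf : Measurable f) :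
    (∫⁻ t in Ioo 0 (π / 2), f t) ^ (3 : ℝ) ≤
      (∫⁻ t in Ioo 0 (π / 2), ENNReal.ofReal (cos t * sin t) * f t ^ (3 : ℝ)) *
      (∫⁻ t in Ioo 0 (π / 2), ENNReal.ofReal ((cos t * sin t) ^ (-(1 / 2) : ℝ))) ^ (2 : ℝ) := by
  -- Splitting `f = (w^(1/3) f) · w^(-1/3)` with exponents 3 and 3/2 produces `w f³` and `w^(-1/2)`.
  have hH := ENNReal.lintegral_mul_le_Lp_mul_Lq (volume.restrict (Ioo 0 (π / 2)))
    (p := 3) (q := 3 / 2) (by rw [Real.holderConjugate_iff]; norm_num)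
    (f := fun t => ENNReal.ofReal ((cos t * sin t) ^ (1 / 3 : ℝ)) * f t)
    (g := fun t => ENNReal.ofReal ((cos t * sin t) ^ (-(1 / 3) : ℝ)))
    (by fun_prop) (by fun_prop)
  have e0 : ∫⁻ t in Ioo 0 (π / 2), ((fun t => ENNReal.ofReal ((cos t * sin t) ^ (1 / 3 : ℝ)) * f t) *
      fun t => ENNReal.ofReal ((cos t * sin t) ^ (-(1 / 3) : ℝ))) t =
      ∫⁻ t in Ioo 0 (π / 2), f t := by
    refine setLIntegral_congr_fun measurableSet_Ioo fun t ht => ?_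
    have h := cos_mul_sin_pos ht
    simp only [Pi.mul_apply]
    rw [mul_right_comm, ← ENNReal.ofReal_mul (by positivity), ← rpow_add h]
    norm_num
  have e1 : ∫⁻ t in Ioo 0 (π / 2),
      (ENNReal.ofReal ((cos t * sin t) ^ (1 / 3 : ℝ)) * f t) ^ (3 : ℝ) =
      ∫⁻ t in Ioo 0 (π / 2), ENNReal.ofReal (cos t * sin t) * f t ^ (3 : ℝ) := by
    refine setLIntegral_congr_fun measurableSet_Ioo fun t ht => ?_
    have h := cos_mul_sin_pos ht
    rw [ENNReal.mul_rpow_of_nonneg _ _ (by norm_num),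
      ENNReal.ofReal_rpow_of_nonneg (by positivity) (by norm_num), ← rpow_mul h.le]
    norm_num
  have e2 : ∫⁻ t in Ioo 0 (π / 2),
      ENNReal.ofReal ((cos t * sin t) ^ (-(1 / 3) : ℝ)) ^ (3 / 2 : ℝ) =
      ∫⁻ t in Ioo 0 (π / 2), ENNReal.ofReal ((cos t * sin t) ^ (-(1 / 2) : ℝ)) := by
    refine setLIntegral_congr_fun measurableSet_Ioo fun t ht => ?_
    have h := cos_mul_sin_pos ht
    rw [ENNReal.ofReal_rpow_of_nonneg (by positivity) (by norm_num), ← rpow_mul h.le]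
    norm_num
  rw [e0, e1, e2] at hH
  refine (ENNReal.rpow_le_rpow hH (by norm_num : (0 : ℝ) ≤ 3)).trans_eq ?_
  rw [ENNReal.mul_rpow_of_nonneg _ _ (by norm_num), ← ENNReal.rpow_mul, ← ENNReal.rpow_mul]
  norm_num

/-- The value of the modulus in terms of `I = Γ(1/4)² / (2√π)`. -/
theorem modulus_value_eq :
    ENNReal.ofReal (16 * π ^ 3 / Gamma (1 / 4) ^ 4) =
      ENNReal.ofReal (2 * π) * ENNReal.ofReal (2 * π) *
        (ENNReal.ofReal (Gamma (1 / 4) ^ 2 / (2 * √π)) ^ (2 : ℝ))⁻¹ := by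
  have hG : 0 < Gamma (1 / 4) := Gamma_pos_of_pos (by norm_num)
  have hp : 0 < √π := Real.sqrt_pos.2 pi_pos
  rw [ENNReal.ofReal_rpow_of_nonneg (by positivity) (by norm_num),
    ← ENNReal.ofReal_inv_of_pos (by positivity), ← ENNReal.ofReal_mul (by positivity),
    ← ENNReal.ofReal_mul (by positivity)]
  congr 1
  rw [rpow_two, div_pow, mul_pow, Real.sq_sqrt pi_pos.le]
  field_simp
  ring

theorem modulus_lower_bound :
    ENNReal.ofReal (16 * π ^ 3 / Gamma (1 / 4) ^ 4) ≤
      pathModulus volS3 3 (connectingPaths hopfLink₀ hopfLink₁) := by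
  refine le_iInf₂ fun ρ hρ => ?_
  have hG : 0 < Gamma (1 / 4) := Gamma_pos_of_pos (by norm_num)
  have hp : 0 < √π := Real.sqrt_pos.2 pi_pos
  set J := ENNReal.ofReal (Gamma (1 / 4) ^ 2 / (2 * √π)) ^ (2 : ℝ) with hJ
  have hJtop : J ≠ ⊤ := ENNReal.rpow_ne_top_of_nonneg (by norm_num) ENNReal.ofReal_ne_top
  have hJ0 : J ≠ 0 := by
    rw [hJ, ENNReal.ofReal_rpow_of_nonneg (by positivity) (by norm_num)]
    exact (ENNReal.ofReal_pos.2 (by positivity)).ne'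
  have key : ∀ α β : ℝ, J⁻¹ ≤ ∫⁻ t in Ioo 0 (π / 2),
      ENNReal.ofReal (cos t * sin t) * ρ (hopfPoint α β t) ^ (3 : ℝ) := by
    intro α β
    have h1 := lintegral_rpow_three_le (hρ.1.comp (measurable_hopfPoint α β))
    rw [lintegral_cos_mul_sin_rpow, ← hJ] at h1
    have h2 := ENNReal.rpow_le_rpow (one_le_lintegral_hopfPoint hρ α β)
      (by norm_num : (0 : ℝ) ≤ 3)
    rw [ENNReal.one_rpow] at h2
    rw [← one_div]
    exact ENNReal.div_le_of_le_mul (h2.trans h1)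
  rw [lintegral_volS3 (hρ.1.pow_const 3), modulus_value_eq, ← hJ]
  calc ENNReal.ofReal (2 * π) * ENNReal.ofReal (2 * π) * J⁻¹
      = ∫⁻ α in Ioo (-π) π, ∫⁻ β in Ioo (-π) π, J⁻¹ := by
        simp only [setLIntegral_const, Real.volume_Ioo]
        rw [show π - -π = 2 * π by ring]
        ring
    _ ≤ _ := lintegral_mono fun α => lintegral_mono fun β => key α β

/-! ### Upper bound: the angle function and its extremal density. -/

/-- The geodesic distance of a point of `𝕊³` to `hopfLink₀`. -/
noncomputable def hopfAngle (x : S3) : ℝ := arcsin ‖x.1 1‖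

theorem norm_sq_add_norm_sq (x : S3) : ‖x.1 0‖ ^ 2 + ‖x.1 1‖ ^ 2 = 1 := by
  have h : ‖x.1‖ = 1 := norm_eq_of_mem_sphere x
  rw [EuclideanSpace.norm_eq, Fin.sum_univ_two, Real.sqrt_eq_one] at h
  exact h

theorem sin_hopfAngle (x : S3) : sin (hopfAngle x) = ‖x.1 1‖ :=
  sin_arcsin (by linarith [norm_nonneg (x.1 1)])
    (by nlinarith [norm_sq_add_norm_sq x, norm_nonneg (x.1 1), sq_nonneg ‖x.1 0‖])

theorem cos_hopfAngle (x : S3) : cos (hopfAngle x) = ‖x.1 0‖ := by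
  rw [hopfAngle, cos_arcsin, show 1 - ‖x.1 1‖ ^ 2 = ‖x.1 0‖ ^ 2 by linarith [norm_sq_add_norm_sq x],
    Real.sqrt_sq (norm_nonneg _)]

theorem hopfAngle_mem_Icc (x : S3) : hopfAngle x ∈ Icc 0 (π / 2) :=
  ⟨arcsin_nonneg.2 (norm_nonneg _), arcsin_le_pi_div_two _⟩

theorem continuous_hopfAngle : Continuous hopfAngle := by
  unfold hopfAngle
  fun_prop

theorem hopfAngle_hopfPoint (α β : ℝ) {t : ℝ} (ht : t ∈ Icc 0 (π / 2)) :
    hopfAngle (hopfPoint α β t) = t := by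
  have hs : 0 ≤ sin t := sin_nonneg_of_nonneg_of_le_pi ht.1 (by linarith [ht.2, pi_pos])
  have : ‖(hopfPoint α β t).1 1‖ = sin t := by
    simp only [hopfPoint, Matrix.cons_val_one, Matrix.cons_val_zero, norm_mul,
      Complex.norm_exp_ofReal_mul_I, mul_one, Complex.norm_real, Real.norm_eq_abs, abs_of_nonneg hs]
  rw [hopfAngle, this, arcsin_sin (by linarith [ht.1, pi_pos]) ht.2]

/-- The left side is the chord between `(‖x 0‖, ‖x 1‖)` and `(‖y 0‖, ‖y 1‖)` on the unit circle;
taking norms coordinatewise is a contraction. -/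
theorem two_mul_sin_half_le_dist (x y : S3) :
    2 * sin (|hopfAngle x - hopfAngle y| / 2) ≤ dist x y := by
  refine le_of_sq_le_sq ?_ dist_nonneg
  have h1 : (2 * sin (|hopfAngle x - hopfAngle y| / 2)) ^ 2 =
      2 - 2 * cos (hopfAngle x - hopfAngle y) := by
    rw [← cos_abs (hopfAngle x - hopfAngle y), mul_pow, sin_sq_eq_half_sub]
    ring_nf
  have h2 : ∀ i : Fin 2, (‖x.1 i‖ - ‖y.1 i‖) ^ 2 ≤ dist (x.1 i) (y.1 i) ^ 2 := by
    intro i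
    rw [dist_eq_norm]
    exact sq_le_sq' (by linarith [norm_sub_norm_le (y.1 i) (x.1 i), norm_sub_rev (x.1 i) (y.1 i)])
      (norm_sub_norm_le _ _)
  rw [h1, cos_sub, cos_hopfAngle, cos_hopfAngle, sin_hopfAngle, sin_hopfAngle, Subtype.dist_eq,
    EuclideanSpace.dist_eq, Real.sq_sqrt (by positivity), Fin.sum_univ_two]
  nlinarith [h2 0, h2 1, norm_sq_add_norm_sq x, norm_sq_add_norm_sq y]

/-- In the chordal metric the angle is only almost 1-Lipschitz at small scales; the constant `1 / (1
- δ²)` tends to 1 with `δ`. -/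
theorem mul_abs_hopfAngle_sub_le {δ : ℝ} {x y : S3} (h : dist x y ≤ δ) :
    (1 - δ ^ 2) * |hopfAngle x - hopfAngle y| ≤ dist x y := by
  set u := |hopfAngle x - hopfAngle y| / 2 with hu
  have hd : 2 * sin u ≤ dist x y := two_mul_sin_half_le_dist x y
  have hx := hopfAngle_mem_Icc x
  have hy := hopfAngle_mem_Icc y
  have habs : |hopfAngle x - hopfAngle y| ≤ π / 2 :=
    abs_le.2 ⟨by linarith [hx.1, hy.2], by linarith [hx.2, hy.1]⟩
  have hθ : |hopfAngle x - hopfAngle y| = 2 * u := by rw [hu]; ring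
  have hu0 : 0 ≤ u := by positivity
  have hu1 : u ≤ 1 := by linarith [pi_lt_four]
  have hδ : 0 ≤ δ := dist_nonneg.trans h
  rcases hu0.eq_or_lt with h0 | h0
  · rw [hθ, ← h0]; simp [dist_nonneg]
  have hs1 : u - u ^ 3 / 6 < sin u := sin_gt_sub_cube h0
  -- This crude bound yields `u ≤ δ`, which turns the cubic error of `sin u` into a multiple of `u
  -- δ²`.
  have hs2 : u / 2 ≤ sin u := by nlinarith [pow_le_one₀ hu0 hu1 (n := 2)]
  have hu2 : u ≤ δ := by linarith
  rw [hθ]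
  have : u ^ 3 ≤ u * δ ^ 2 := by
    have := pow_le_pow_left₀ hu0 hu2 2
    nlinarith
  nlinarith [mul_nonneg hu0 (sq_nonneg δ)]

/-- A Lipschitz bound at scale `δ` suffices: separability cuts the space into countably many
disjoint measurable pieces of diameter at most `δ`, and the estimates on them add up. -/
theorem hausdorffMeasure_image_le_mul {X Y : Type*} [MetricSpace X]
    [SecondCountableTopology X] [MeasurableSpace X] [BorelSpace X] [MetricSpace Y]
    [MeasurableSpace Y] [BorelSpace Y] {f : X → Y} {K : NNReal} {δ : ℝ} (hδ : 0 < δ)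
    (hf : ∀ x y, dist x y ≤ δ → dist (f x) (f y) ≤ K * dist x y) (A : Set X) :
    Measure.hausdorffMeasure 1 (f '' A) ≤ K * Measure.hausdorffMeasure 1 A := by
  rcases A.eq_empty_or_nonempty with rfl | ⟨a, -⟩
  · simp
  have : Nonempty X := ⟨a⟩
  let B : ℕ → Set X := fun n => Metric.ball (TopologicalSpace.denseSeq X n) (δ / 2)
  have hB : ⋃ n, disjointed B n = univ := by
    rw [iUnion_disjointed]
    refine eq_univ_of_forall fun x => ?_
    obtain ⟨n, hn⟩ := (TopologicalSpace.denseRange_denseSeq X).exists_dist_lt x (half_pos hδ)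
    exact mem_iUnion.2 ⟨n, hn⟩
  have hm : ∀ n, MeasurableSet (disjointed B n) :=
    MeasurableSet.disjointed fun n => measurableSet_ball
  have hlip : ∀ n, LipschitzOnWith K f (A ∩ disjointed B n) := by
    refine fun n => LipschitzOnWith.of_dist_le_mul fun x hx y hy => hf x y ?_
    have h1 := disjointed_subset B n hx.2
    have h2 := disjointed_subset B n hy.2
    rw [Metric.mem_ball] at h1 h2
    linarith [dist_triangle_right x y (TopologicalSpace.denseSeq X n)]
  calc Measure.hausdorffMeasure 1 (f '' A)
      = Measure.hausdorffMeasure 1 (⋃ n, f '' (A ∩ disjointed B n)) := by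
        rw [← image_iUnion, ← inter_iUnion, hB, inter_univ]
    _ ≤ ∑' n, Measure.hausdorffMeasure 1 (f '' (A ∩ disjointed B n)) := measure_iUnion_le _
    _ ≤ ∑' n, K * Measure.hausdorffMeasure 1 (A ∩ disjointed B n) := by
        refine ENNReal.tsum_le_tsum fun n => ?_
        simpa using (hlip n).hausdorffMeasure_image_le zero_le_one
    _ = K * Measure.hausdorffMeasure 1 A := by
        have := measure_iUnion (μ := (Measure.hausdorffMeasure 1).restrict A)
          (disjoint_disjointed B) hm
        rw [hB, Measure.restrict_apply_univ] at this
        rw [ENNReal.tsum_mul_left, this]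
        simp only [Measure.restrict_apply (hm _), inter_comm]

theorem hausdorffMeasure_hopfAngle_image_le (A : Set S3) :
    volume (hopfAngle '' A) ≤ Measure.hausdorffMeasure 1 A := by
  have h : ∀ δ : ℝ, δ ∈ Ioo (0 : ℝ) 1 → volume (hopfAngle '' A) ≤
      ENNReal.ofReal ((1 - δ ^ 2)⁻¹) * Measure.hausdorffMeasure 1 A := by
    intro δ hδ
    have hδ' : 0 < 1 - δ ^ 2 := by nlinarith [hδ.1, hδ.2]
    rw [← hausdorffMeasure_real]
    refine hausdorffMeasure_image_le_mul (f := hopfAngle) (K := ((1 - δ ^ 2)⁻¹).toNNReal) hδ.1 (fun x y hxy => ?_) A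
    rw [Real.coe_toNNReal _ (by positivity), Real.dist_eq, inv_mul_eq_div, le_div_iff₀' hδ']
    exact mul_abs_hopfAngle_sub_le hxy
  have hc : Tendsto (fun δ : ℝ => ENNReal.ofReal ((1 - δ ^ 2)⁻¹)) (𝓝[>] 0) (𝓝 1) := by
    have : ContinuousAt (fun δ : ℝ => ENNReal.ofReal ((1 - δ ^ 2)⁻¹)) 0 := by
      refine ENNReal.continuous_ofReal.continuousAt.comp ?_
      exact ContinuousAt.inv₀ (by fun_prop) (by norm_num)
    simpa using this.tendsto.mono_left nhdsWithin_le_nhds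
  -- `ℋ¹(A)` may be infinite; the product still converges because the limit 1 of the other factor is
  -- nonzero.
  have hlim := ENNReal.Tendsto.mul_const (b := Measure.hausdorffMeasure 1 A) hc
    (Or.inl one_ne_zero)
  rw [one_mul] at hlim
  refine ge_of_tendsto hlim ?_
  filter_upwards [Ioo_mem_nhdsGT one_pos] with δ hδ using h δ hδ

/-- Intermediate value property: the angle is 0 on one link component and `π / 2` on the other. -/
theorem Icc_subset_hopfAngle_image {γ : C(unitInterval, S3)}
    (hγ : γ ∈ connectingPaths hopfLink₀ hopfLink₁) : Icc 0 (π / 2) ⊆ hopfAngle '' range γ := by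
  have h0 : ∀ x ∈ hopfLink₀, hopfAngle x = 0 := fun x hx => by simp [hopfAngle, hx.2]
  have h1 : ∀ x ∈ hopfLink₁, hopfAngle x = π / 2 := fun x hx => by simp [hopfAngle, hx.2]
  have hconn : (hopfAngle '' range γ).OrdConnected :=
    ((isPreconnected_range γ.continuous).image _ continuous_hopfAngle.continuousOn).ordConnected
  have m0 : hopfAngle (γ 0) ∈ hopfAngle '' range γ := mem_image_of_mem _ (mem_range_self _)
  have m1 : hopfAngle (γ 1) ∈ hopfAngle '' range γ := mem_image_of_mem _ (mem_range_self _)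
  rcases hγ with ⟨a, b⟩ | ⟨a, b⟩
  · rw [h0 _ a] at m0
    rw [h1 _ b] at m1
    exact hconn.out m0 m1
  · rw [h1 _ a] at m0
    rw [h0 _ b] at m1
    exact hconn.out m1 m0

/-- The pushforward of `ℋ¹` on the path under the angle dominates Lebesgue measure on `[0, π/2]`.
Paths of infinite length need no separate treatment. -/
theorem setLIntegral_le_lintegral_hopfAngle {γ : C(unitInterval, S3)}
    (hγ : γ ∈ connectingPaths hopfLink₀ hopfLink₁) {h : ℝ → ENNReal} (hh : Measurable h) :
    ∫⁻ t in Icc 0 (π / 2), h t ≤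
      ∫⁻ x in range γ, h (hopfAngle x) ∂(Measure.hausdorffMeasure 1) := by
  have hm := continuous_hopfAngle.measurable
  rw [← lintegral_map hh hm]
  refine lintegral_mono' (Measure.le_iff.2 fun B hB => ?_) le_rfl
  rw [Measure.restrict_apply hB, Measure.map_apply hm hB, Measure.restrict_apply (hm hB)]
  refine (measure_mono ?_).trans (hausdorffMeasure_hopfAngle_image_le _)
  rintro t ⟨htB, ht⟩
  obtain ⟨x, hx, rfl⟩ := Icc_subset_hopfAngle_image hγ ht
  exact ⟨x, ⟨htB, hx⟩, rfl⟩

theorem modulus_upper_bound :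
    pathModulus volS3 3 (connectingPaths hopfLink₀ hopfLink₁) ≤
      ENNReal.ofReal (16 * π ^ 3 / Gamma (1 / 4) ^ 4) := by
  have hG : 0 < Gamma (1 / 4) := Gamma_pos_of_pos (by norm_num)
  have hp : 0 < √π := Real.sqrt_pos.2 pi_pos
  have hI := lintegral_cos_mul_sin_rpow
  set I := ENNReal.ofReal (Gamma (1 / 4) ^ 2 / (2 * √π)) with hIdef
  have hItop : I ≠ ⊤ := ENNReal.ofReal_ne_top
  have hI0 : I ≠ 0 := (ENNReal.ofReal_pos.2 (by positivity)).ne'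
  have hIinv : I⁻¹ ≠ ⊤ := ENNReal.inv_ne_top.2 hI0
  -- The equality case of Hölder, normalised to have integral 1 over `(0, π/2)`.
  let h : ℝ → ENNReal := fun t => I⁻¹ * ENNReal.ofReal ((cos t * sin t) ^ (-(1 / 2) : ℝ))
  have hh : Measurable h := by fun_prop
  have hρ : (fun x => h (hopfAngle x)) ∈
      AdmissibleDensities (connectingPaths hopfLink₀ hopfLink₁) := by
    refine ⟨hh.comp continuous_hopfAngle.measurable, fun γ hγ => ?_⟩
    refine le_trans ?_ (setLIntegral_le_lintegral_hopfAngle hγ hh)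
    -- At the right endpoint the real power of 0 takes a junk value; passing to the open interval
    -- discards it.
    rw [← setLIntegral_congr Ioo_ae_eq_Icc, lintegral_const_mul' _ _ hIinv, hI,
      ENNReal.inv_mul_cancel hI0 hItop]
  refine (iInf₂_le _ hρ).trans_eq ?_
  rw [lintegral_volS3 (hρ.1.pow_const 3), modulus_value_eq, ← hIdef]
  have key : ∀ α β : ℝ, ∫⁻ t in Ioo 0 (π / 2), ENNReal.ofReal (cos t * sin t) *
      h (hopfAngle (hopfPoint α β t)) ^ (3 : ℝ) = (I ^ (2 : ℝ))⁻¹ := by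
    intro α β
    have : ∀ t ∈ Ioo 0 (π / 2), ENNReal.ofReal (cos t * sin t) *
        h (hopfAngle (hopfPoint α β t)) ^ (3 : ℝ) =
        I⁻¹ ^ (3 : ℝ) * ENNReal.ofReal ((cos t * sin t) ^ (-(1 / 2) : ℝ)) := by
      intro t ht
      have hcs := cos_mul_sin_pos ht
      rw [hopfAngle_hopfPoint α β (Ioo_subset_Icc_self ht),
        ENNReal.mul_rpow_of_nonneg _ _ (by norm_num),
        ENNReal.ofReal_rpow_of_nonneg (by positivity) (by norm_num), mul_left_comm,
        ← ENNReal.ofReal_mul hcs.le, ← rpow_mul hcs.le, ← rpow_one_add' hcs.le (by norm_num)]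
      norm_num
    rw [setLIntegral_congr_fun measurableSet_Ioo this, lintegral_const_mul'
      _ _ (ENNReal.rpow_ne_top_of_nonneg (by norm_num) hIinv), hI,
      show (3 : ℝ) = 2 + 1 by norm_num,
      ENNReal.rpow_add _ _ (ENNReal.inv_ne_zero.2 hItop) hIinv, ENNReal.rpow_one, mul_assoc,
      ENNReal.inv_mul_cancel hI0 hItop, mul_one, ENNReal.inv_rpow]
  simp only [key, setLIntegral_const, Real.volume_Ioo]
  rw [show π - -π = 2 * π by ring]
  ring

theorem mainTheorem5 :
    pathModulus volS3 3 (connectingPaths hopfLink₀ hopfLink₁) =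
      ENNReal.ofReal (16 * Real.pi ^ 3 / Real.Gamma (1 / 4) ^ 4) :=
  le_antisymm modulus_upper_bound modulus_lower_bound
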